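/- Let $n\ge 0$ be an integer and let $\mathbb P^n$ be the complex projective space of lines in $\mathbb C^{n+1}$, with its usual topology and its Borel $\sigma$-algebra. For a Borel probability measure $\mu$ on $\mathbb P^n$ let $$I(\mu)=-\int_{\mathbb P^n}\int_{\mathbb P^n}\log\frac{|\zeta\wedge\eta|}{|\zeta|\,|\eta|}\,d\mu(\zeta)\,d\mu(\eta)\in[0,+\infty],$$ where $|\cdot|$ is the Euclidean norm, $|\zeta\wedge\eta|^2=\sum_{i<j}|\zeta_i\eta_j-\zeta_j\eta_i|^2$ and $\log 0=-\infty$. For $E\subset\mathbb P^n$ put $$\gamma(E)=\inf\{I(\mu):\mu \text{ a Borel probability measure on }\mathbb P^n,\ \operatorname{Supp}\mu\subset E\},\qquad \kappa(E)=e^{-\gamma(E)}$$ (with $\inf\emptyset=+\infty$ and $e^{-\infty}=0$), and define the outer and inner projective logarithmic capacities $$\kappa^*(E)=\inf\{\kappa(O): O\supset E,\ O\text{ open in }\mathbb P^n\},\qquad \kappa_*(E)=\sup\{\kappa(K):K\subset E,\ K\text{ compact}\}.$$ **Theorem.** The set function $\kappa^*$ is a Choquet capacity on $\mathbb P^n$,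 that is: 1. $\kappa^*(\emptyset)=0$, and $\kappa^*(A)\le\kappa^*(B)$ whenever $A\subset B\subset\mathbb P^n$; 2. if $E_1\subset E_2\subset\cdots$ are arbitrary subsets of $\mathbb P^n$, then $\kappa^*\bigl(\bigcup_j E_j\bigr)=\lim_{j\to\infty}\kappa^*(E_j)$; 3. if $K_1\supset K_2\supset\cdots$ are compact subsets of $\mathbb P^n$, then $\kappa^*\bigl(\bigcap_j K_j\bigr)=\lim_{j\to\infty}\kappa^*(K_j)$. In particular, every Borel set $E\subset\mathbb P^n$ is capacitable: $\kappa^*(E)=\kappa_*(E)$. -/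

import Mathlib

open MeasureTheory Filter Topology
open scoped ENNReal LinearAlgebra.Projectivization

namespace ProjLog

/-- The complex projective space `ℙⁿ`: the complex lines through the origin of `ℂⁿ⁺¹`. -/
abbrev CP (n : ℕ) : Type :=
  ℙ ℂ (EuclideanSpace ℂ (Fin (n + 1)))

/-- The quotient topology of `ℂⁿ⁺¹ ∖ {0} → ℙⁿ`. -/
instance instTopologicalSpaceCP (n : ℕ) : TopologicalSpace (CP n) :=
  inferInstanceAs (TopologicalSpace
    (Quotient (projectivizationSetoid ℂ (EuclideanSpace ℂ (Fin (n + 1))))))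

/-- The Borel `σ`-algebra of `ℙⁿ`. -/
instance instMeasurableSpaceCP (n : ℕ) : MeasurableSpace (CP n) :=
  borel (CP n)

instance instBorelSpaceCP (n : ℕ) : BorelSpace (CP n) :=
  ⟨rfl⟩

/-- The Euclidean norm `|v ∧ w|` of the bivector `v ∧ w`, whose coordinates are
`vᵢ wⱼ - vⱼ wᵢ` for `i < j`. -/
noncomputable def wedgeNorm {n : ℕ} (v w : EuclideanSpace ℂ (Fin (n + 1))) : ℝ :=
  √(∑ i, ∑ j ∈ Finset.Ioi i, ‖v i * w j - v j * w i‖ ^ 2)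

/-- The quotient `|ζ ∧ η| / (|ζ| |η|)` of two points of `ℙⁿ`, computed on representatives. -/
noncomputable def wedgeRatio {n : ℕ} (ζ η : CP n) : ℝ :=
  wedgeNorm ζ.rep η.rep / (‖ζ.rep‖ * ‖η.rep‖)

theorem wedgeNorm_smul {n : ℕ} (a b : ℂ) (v w : EuclideanSpace ℂ (Fin (n + 1))) :
    wedgeNorm (a • v) (b • w) = ‖a‖ * ‖b‖ * wedgeNorm v w := by
  have h : ∀ i j : Fin (n + 1),
      ‖(a • v) i * (b • w) j - (a • v) j * (b • w) i‖ ^ 2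
        = (‖a‖ * ‖b‖) ^ 2 * ‖v i * w j - v j * w i‖ ^ 2 := by
    intro i j
    have e : (a • v) i * (b • w) j - (a • v) j * (b • w) i
        = (a * b) * (v i * w j - v j * w i) := by
      simp only [PiLp.smul_apply, smul_eq_mul]; ring
    rw [e, norm_mul, norm_mul]; ring
  unfold wedgeNorm
  simp only [h, ← Finset.mul_sum]
  rw [Real.sqrt_mul (by positivity), Real.sqrt_sq (by positivity)]

theorem wedgeNorm_le {n : ℕ} (v w : EuclideanSpace ℂ (Fin (n + 1))) :
    wedgeNorm v w ≤ ‖v‖ * ‖w‖ := by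
  unfold wedgeNorm
  rw [Real.sqrt_le_left (by positivity), mul_pow, EuclideanSpace.norm_sq_eq,
    EuclideanSpace.norm_sq_eq]
  set f : Fin (n + 1) → Fin (n + 1) → ℝ := fun i j => ‖v i * w j - v j * w i‖ ^ 2 with hf
  have hs : ∀ i j, f j i = f i j := fun i j => by
    simp only [hf]; rw [← norm_neg]; congr 2; ring
  have hd : ∀ i, f i i = 0 := fun i => by simp [hf]
  have h1 : 2 * ∑ i, ∑ j ∈ Finset.Ioi i, f i j = ∑ i, ∑ j, f i j := by
    have h := Finset.sum_sum_Ioi_add_eq_sum_sum_off_diag f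
    have h3 : ∀ i, ∑ j ∈ {i}ᶜ, f j i = ∑ j, f i j := fun i => by
      rw [← Finset.sum_compl_add_sum {i}, Finset.sum_singleton, hd, add_zero]
      exact Finset.sum_congr rfl fun j _ => hs i j
    rw [← Finset.sum_congr rfl fun i _ => h3 i, ← h, Finset.mul_sum]
    refine Finset.sum_congr rfl fun i _ => ?_
    rw [Finset.mul_sum]
    exact Finset.sum_congr rfl fun j _ => by rw [hs i j, two_mul]
  have h4 : (((∑ i, ∑ j, f i j : ℝ)) : ℂ) = ((2 * ((∑ i, ‖v i‖ ^ 2) * ∑ i, ‖w i‖ ^ 2)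
      - 2 * ‖∑ i, v i * (starRingEnd ℂ) (w i)‖ ^ 2 : ℝ) : ℂ) := by
    push_cast
    simp only [hf]
    push_cast
    simp only [← Complex.mul_conj', map_sub, map_mul, map_sum, Complex.conj_conj]
    rw [Finset.sum_mul_sum, Finset.sum_mul_sum]
    have e : ∀ i j : Fin (n + 1), (v i * w j - v j * w i) *
        ((starRingEnd ℂ) (v i) * (starRingEnd ℂ) (w j)
          - (starRingEnd ℂ) (v j) * (starRingEnd ℂ) (w i))
        = (v i * (starRingEnd ℂ) (v i) * (w j * (starRingEnd ℂ) (w j))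
          - v i * (starRingEnd ℂ) (w i) * ((starRingEnd ℂ) (v j) * w j))
        + (v j * (starRingEnd ℂ) (v j) * (w i * (starRingEnd ℂ) (w i))
          - v j * (starRingEnd ℂ) (w j) * ((starRingEnd ℂ) (v i) * w i)) := fun i j => by ring
    simp only [e, Finset.sum_add_distrib, Finset.sum_sub_distrib]
    rw [Finset.sum_comm (f := fun i j => v j * (starRingEnd ℂ) (v j) * (w i * (starRingEnd ℂ) (w i))),
      Finset.sum_comm (f := fun i j => v j * (starRingEnd ℂ) (w j) * ((starRingEnd ℂ) (v i) * w i))]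
    ring
  have h5 := Complex.ofReal_injective h4
  nlinarith [sq_nonneg ‖∑ i, v i * (starRingEnd ℂ) (w i)‖]

/-- The quotient does not depend on the choice of the representatives. -/
theorem wedgeRatio_mk {n : ℕ} (v w : EuclideanSpace ℂ (Fin (n + 1))) (hv : v ≠ 0) (hw : w ≠ 0) :
    wedgeRatio (Projectivization.mk ℂ v hv) (Projectivization.mk ℂ w hw)
      = wedgeNorm v w / (‖v‖ * ‖w‖) := by
  obtain ⟨a, ha⟩ := Projectivization.exists_smul_eq_mk_rep ℂ v hv
  obtain ⟨b, hb⟩ := Projectivization.exists_smul_eq_mk_rep ℂ w hw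
  have ha0 : ‖(a : ℂ)‖ ≠ 0 := norm_ne_zero_iff.2 a.ne_zero
  have hb0 : ‖(b : ℂ)‖ ≠ 0 := norm_ne_zero_iff.2 b.ne_zero
  have hv0 : ‖v‖ ≠ 0 := norm_ne_zero_iff.2 hv
  have hw0 : ‖w‖ ≠ 0 := norm_ne_zero_iff.2 hw
  unfold wedgeRatio
  rw [← ha, ← hb, Units.smul_def, Units.smul_def, wedgeNorm_smul, norm_smul, norm_smul]
  field_simp

/-- The projective logarithmic kernel `G(ζ, η) = log (|ζ ∧ η| / (|ζ| |η|))`, with values in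
`[-∞, 0]` and `log 0 = -∞`. -/
noncomputable def kernelG {n : ℕ} (ζ η : CP n) : EReal :=
  ENNReal.log (ENNReal.ofReal (wedgeRatio ζ η))

theorem kernelG_nonpos {n : ℕ} (ζ η : CP n) : kernelG ζ η ≤ 0 := by
  have h : wedgeRatio ζ η ≤ 1 :=
    div_le_one_of_le₀ (wedgeNorm_le _ _) (by positivity)
  rw [kernelG, ← ENNReal.log_one]
  exact ENNReal.log_monotone (ENNReal.ofReal_le_one.2 h)

/-- The projective logarithmic energy `I(μ) = - ∫∫ G(ζ, η) dμ(ζ) dμ(η)`, with values in `[0, +∞]`.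
The integrand `-G` is nonnegative, so that nothing is lost in `EReal.toENNReal`. -/
noncomputable def energy {n : ℕ} (μ : ProbabilityMeasure (CP n)) : ℝ≥0∞ :=
  ∫⁻ η, ∫⁻ ζ, (-kernelG ζ η).toENNReal ∂(μ : Measure (CP n)) ∂(μ : Measure (CP n))

/-- The Robin constant `γ(E) = inf {I(μ) : μ a Borel probability measure on ℙⁿ, supp μ ⊆ E}`,
where `inf ∅ = +∞`. -/
noncomputable def robin {n : ℕ} (E : Set (CP n)) : ℝ≥0∞ :=
  ⨅ (μ : ProbabilityMeasure (CP n)) (_ : (μ : Measure (CP n)).support ⊆ E), energy μ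

/-- The projective logarithmic capacity `κ(E) = exp (-γ(E))`, where `exp (-∞) = 0`. -/
noncomputable def kappa {n : ℕ} (E : Set (CP n)) : ℝ≥0∞ :=
  EReal.exp (-(robin E : EReal))

/-- The outer projective logarithmic capacity `κ*`. -/
noncomputable def kappaOuter {n : ℕ} (E : Set (CP n)) : ℝ≥0∞ :=
  ⨅ (O : Set (CP n)) (_ : IsOpen O) (_ : E ⊆ O), kappa O

/-- The inner projective logarithmic capacity `κ_*`. -/
noncomputable def kappaInner {n : ℕ} (E : Set (CP n)) : ℝ≥0∞ :=
  ⨆ (K : Set (CP n)) (_ : IsCompact K) (_ : K ⊆ E), kappa K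

/-- `E` is capacitable if its outer and inner projective logarithmic capacities agree. -/
def IsCapacitable {n : ℕ} (E : Set (CP n)) : Prop :=
  kappaOuter E = kappaInner E

/-- A set function `c`, defined on all subsets of a topological space, is a Choquet capacity. -/
structure IsChoquetCapacity {X : Type*} [TopologicalSpace X] (c : Set X → ℝ≥0∞) : Prop where
  empty : c ∅ = 0
  mono : ∀ A B : Set X, A ⊆ B → c A ≤ c B
  tendsto_iUnion : ∀ E : ℕ → Set X, Monotone E →
    Tendsto (fun j => c (E j)) atTop (𝓝 (c (⋃ j, E j)))
  tendsto_iInter : ∀ K : ℕ → Set X, Antitone K → (∀ j, IsCompact (K j)) →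
    Tendsto (fun j => c (K j)) atTop (𝓝 (c (⋂ j, K j)))

end ProjLog

/-! With `r = |ζ ∧ η| / (|ζ| |η|)`, the logarithmic series gives `-log r = ½ ∑ (1 - r²)ᵏ⁺¹ / (k +
1)`, and `1 - r²` is the trace inner product of the orthogonal projections onto the two lines.
Tensor powers thus write `-G` as a sum of nonnegative positive definite kernels
(`tsum_inner_feature`), and the energy of a measure becomes the squared norm of its vector of
moments in a Hilbert space.

Vectors of measures of finite energy form a convex cone with nonnegative mutual inner products, so
the metric projection onto its closure serves as a positive part. For open `O` there is a duality
(`exists_mem_dominators`, `le_minEnergy_of_mem_dominators`): for `v > 0`, the least energy on `O` is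
at least `v` exactly when some `h` with `‖h‖² ≤ 1/v` has potential at least `1` on `O`.

Continuity along increasing sets (`outerMinEnergy_iUnion`) then needs one vector good for all `Eⱼ`.
The dominators of neighbourhoods of `Eⱼ` form decreasing convex sets meeting a fixed ball, so their
closures share a point `p` of the ball. Choosing `hⱼ` close to `p` with summable errors, `p⁺ + ∑ (hⱼ
- p)⁺` dominates every `hⱼ` at little cost in norm.

Decreasing compact sets are handled by compactness alone. Capacitability follows from Choquet's
theorem for analytic sets, together with the equality of `κ*` and `κ` on compact sets
(`outerMinEnergy_of_isCompact`). -/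

namespace ProjLog

set_option linter.unusedSectionVars false

/-! ### Metric projections onto convex sets and cones -/

section Cone

variable {H : Type*} [NormedAddCommGroup H] [InnerProductSpace ℝ H] [CompleteSpace H]

/-- In a self-positive convex cone of a Hilbert space, the metric projection onto the closure of
the cone plays the role of the positive part. -/
theorem exists_positivePart_of_cone {P : Set H} (h0 : (0 : H) ∈ P)
    (hadd : ∀ x ∈ P, ∀ y ∈ P, x + y ∈ P) (hconv : Convex ℝ P)
    (hpos : ∀ x ∈ P, ∀ y ∈ P, 0 ≤ inner ℝ x y) (f : H) :
    ∃ p : H, ‖p‖ ≤ ‖f‖ ∧ ∀ x ∈ P, 0 ≤ inner ℝ p x ∧ inner ℝ f x ≤ inner ℝ p x := by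
  have hne : (closure P).Nonempty := ⟨0, subset_closure h0⟩
  obtain ⟨p, hp, hpm⟩ := exists_norm_eq_iInf_of_complete_convex hne
    isClosed_closure.isComplete hconv.closure f
  have hin := (norm_eq_iInf_iff_real_inner_le_zero hconv.closure hp).1 hpm
  refine ⟨p, ?_, fun x hx => ⟨?_, ?_⟩⟩
  · have h := hin 0 (subset_closure h0)
    rw [zero_sub, inner_neg_right, inner_sub_left, real_inner_self_eq_norm_sq] at h
    have h' := real_inner_le_norm f p
    by_contra! hlt
    nlinarith [norm_nonneg f, norm_nonneg p]
  · refine closure_minimal (t := {z : H | 0 ≤ inner ℝ z x}) (fun z hz => hpos z hz x hx) ?_ hp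
    exact isClosed_le continuous_const (by fun_prop)
  -- Testing the variational inequality at `p + x` instead of `x` leaves exactly `⟪f - p, x⟫ ≤ 0`.
  · have hmem : p + x ∈ closure P :=
      closure_minimal (t := {z : H | z + x ∈ closure P})
        (fun z hz => subset_closure (hadd z hz x hx))
        (isClosed_closure.preimage (by fun_prop)) hp
    have h := hin _ hmem
    rw [add_sub_cancel_left, inner_sub_left] at h
    linarith

/-- A point of least norm in the closure of a convex set, in variational form. -/
theorem exists_forall_le_inner_of_convex {S : Set H} (hne : S.Nonempty) (hconv : Convex ℝ S) :
    ∃ p ∈ closure S, ∀ x ∈ S, ‖p‖ ^ 2 ≤ inner ℝ p x := by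
  obtain ⟨p, hp, hpm⟩ := exists_norm_eq_iInf_of_complete_convex hne.closure
    isClosed_closure.isComplete hconv.closure 0
  have hin := (norm_eq_iInf_iff_real_inner_le_zero hconv.closure hp).1 hpm
  refine ⟨p, hp, fun x hx => ?_⟩
  have h := hin x (subset_closure hx)
  rw [zero_sub, inner_neg_left, inner_sub_right, real_inner_self_eq_norm_sq] at h
  linarith

end Cone

/-! ### Measures as vectors of a Hilbert sum -/

section Energy

variable {X : Type*} [TopologicalSpace X] [CompactSpace X] [T2Space X]
  [SecondCountableTopology X] [MeasurableSpace X] [BorelSpace X]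

theorem integrable_of_continuous {E : Type*} [NormedAddCommGroup E] {f : X → E}
    (hf : Continuous f) (μ : Measure X) [IsFiniteMeasure μ] : Integrable f μ :=
  hf.integrable_of_hasCompactSupport (HasCompactSupport.of_compactSpace f)

theorem inner_integral_integral {E : Type*} [NormedAddCommGroup E] [InnerProductSpace ℝ E]
    [CompleteSpace E] {f : X → E} (hf : Continuous f) (μ ν : Measure X) [IsFiniteMeasure μ]
    [IsFiniteMeasure ν] :
    inner ℝ (∫ x, f x ∂μ) (∫ y, f y ∂ν) = ∫ y, ∫ x, inner ℝ (f x) (f y) ∂μ ∂ν := by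
  rw [← integral_inner (integrable_of_continuous hf ν)]
  refine integral_congr_ae (ae_of_all _ fun y => ?_)
  simp only
  rw [real_inner_comm, ← integral_inner (integrable_of_continuous hf μ)]
  exact integral_congr_ae (ae_of_all _ fun x => real_inner_comm _ _)

variable {V : ℕ → Type*} [∀ k, NormedAddCommGroup (V k)] [∀ k, InnerProductSpace ℝ (V k)]
  [∀ k, CompleteSpace (V k)]

/-- The energy of a measure for the positive definite kernel `∑ₖ ⟪Φₖ x, Φₖ y⟫`. -/
noncomputable def seriesEnergy (Φ : ∀ k, X → V k) (μ : Measure X) : ℝ≥0∞ :=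
  ∫⁻ y, ∫⁻ x, ∑' k, ENNReal.ofReal (inner ℝ (Φ k x) (Φ k y)) ∂μ ∂μ

theorem seriesEnergy_mono {Φ : ∀ k, X → V k} {μ ν : Measure X} (h : μ ≤ ν) :
    seriesEnergy Φ μ ≤ seriesEnergy Φ ν :=
  lintegral_mono' h fun _ => lintegral_mono' h le_rfl

/-- Nonnegativity allows exchanging sum and integrals; in each term the double integral of the inner
product is the squared norm of the vector integral. -/
theorem seriesEnergy_eq {Φ : ∀ k, X → V k} (hΦ : ∀ k, Continuous (Φ k))
    (hpos : ∀ k x y, 0 ≤ inner ℝ (Φ k x) (Φ k y)) (μ : Measure X) [IsFiniteMeasure μ] :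
    seriesEnergy Φ μ = ∑' k, ENNReal.ofReal (‖∫ x, Φ k x ∂μ‖ ^ 2) := by
  have hc : ∀ k, Continuous fun z : X × X => inner ℝ (Φ k z.2) (Φ k z.1) := fun k => by
    have := hΦ k
    fun_prop
  unfold seriesEnergy
  have h1 : ∀ y, ∫⁻ x, ∑' k, ENNReal.ofReal (inner ℝ (Φ k x) (Φ k y)) ∂μ
      = ∑' k, ∫⁻ x, ENNReal.ofReal (inner ℝ (Φ k x) (Φ k y)) ∂μ := fun y => by
    refine lintegral_tsum fun k => ?_
    have := hΦ k
    exact (ENNReal.continuous_ofReal.comp (by fun_prop :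
      Continuous fun x => inner ℝ (Φ k x) (Φ k y))).measurable.aemeasurable
  simp only [h1]
  rw [lintegral_tsum]
  · refine tsum_congr fun k => ?_
    rw [← real_inner_self_eq_norm_sq, inner_integral_integral (hΦ k)]
    have hk := hΦ k
    have h2 : ∀ y, Integrable (fun x => inner ℝ (Φ k x) (Φ k y)) μ := fun y =>
      integrable_of_continuous (by fun_prop) μ
    have h3 : (fun y => ∫ x, inner ℝ (Φ k x) (Φ k y) ∂μ)
        = fun y => inner ℝ (Φ k y) (∫ x, Φ k x ∂μ) := by
      funext y
      rw [← integral_inner (integrable_of_continuous hk μ)]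
      exact integral_congr_ae (ae_of_all _ fun x => real_inner_comm _ _)
    rw [ofReal_integral_eq_lintegral_ofReal]
    · refine lintegral_congr fun y => ?_
      rw [ofReal_integral_eq_lintegral_ofReal (h2 y) (ae_of_all _ fun x => hpos k x y)]
    · rw [h3]
      exact integrable_of_continuous (by fun_prop) μ
    · exact ae_of_all _ fun y => integral_nonneg fun x => hpos k x y
  · intro k
    refine (Measurable.lintegral_prod_right' (f := fun z : X × X =>
      ENNReal.ofReal (inner ℝ (Φ k z.2) (Φ k z.1))) ?_).aemeasurable
    exact (ENNReal.continuous_ofReal.comp (hc k)).measurable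

/-- The point `x` of the Hilbert sum of the `V k` is the vector of the integrals `∫ Φₖ dμ`. -/
def Represents (Φ : ∀ k, X → V k) (μ : Measure X) (x : lp V 2) : Prop :=
  ∀ k, x k = ∫ z, Φ k z ∂μ

theorem Represents.seriesEnergy_eq {Φ : ∀ k, X → V k} (hΦ : ∀ k, Continuous (Φ k))
    (hpos : ∀ k x y, 0 ≤ inner ℝ (Φ k x) (Φ k y)) {μ : Measure X} [IsFiniteMeasure μ]
    {x : lp V 2} (hx : Represents Φ μ x) : seriesEnergy Φ μ = ENNReal.ofReal (‖x‖ ^ 2) := by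
  have h := lp.hasSum_inner (𝕜 := ℝ) x x
  simp only [real_inner_self_eq_norm_sq] at h
  rw [ProjLog.seriesEnergy_eq hΦ hpos, ← h.tsum_eq, ENNReal.ofReal_tsum_of_nonneg
    (fun k => by positivity) h.summable]
  exact tsum_congr fun k => by rw [hx k]

/-- Finite energy means square-summable moments, which is membership in the Hilbert sum. -/
theorem exists_represents {Φ : ∀ k, X → V k} (hΦ : ∀ k, Continuous (Φ k))
    (hpos : ∀ k x y, 0 ≤ inner ℝ (Φ k x) (Φ k y)) {μ : Measure X} [IsFiniteMeasure μ]
    (h : seriesEnergy Φ μ ≠ ⊤) : ∃ x : lp V 2, Represents Φ μ x := by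
  have hs : Summable fun k => ‖∫ x, Φ k x ∂μ‖ ^ 2 := by
    rw [ProjLog.seriesEnergy_eq hΦ hpos] at h
    have := ENNReal.summable_toReal h
    simpa [ENNReal.toReal_ofReal] using this
  refine ⟨⟨fun k => ∫ x, Φ k x ∂μ, memℓp_gen ?_⟩, fun k => rfl⟩
  simpa using hs

theorem represents_zero (Φ : ∀ k, X → V k) : Represents Φ (0 : Measure X) 0 := fun k => by simp

theorem Represents.add {Φ : ∀ k, X → V k} (hΦ : ∀ k, Continuous (Φ k)) {μ ν : Measure X}
    [IsFiniteMeasure μ] [IsFiniteMeasure ν] {x y : lp V 2} (hx : Represents Φ μ x)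
    (hy : Represents Φ ν y) : Represents Φ (μ + ν) (x + y) := fun k => by
  rw [integral_add_measure (integrable_of_continuous (hΦ k) μ)
    (integrable_of_continuous (hΦ k) ν), ← hx k, ← hy k]
  rfl

theorem Represents.smul {Φ : ∀ k, X → V k} {μ : Measure X} {x : lp V 2} (hx : Represents Φ μ x)
    {c : ℝ} (hc : 0 ≤ c) : Represents Φ (ENNReal.ofReal c • μ) (c • x) := fun k => by
  rw [integral_smul_measure, ← hx k, ENNReal.toReal_ofReal hc]
  rfl

/-- The mutual energy integrates a nonnegative kernel. This is the self-positivity of the cone, on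
which the positive part rests. -/
theorem Represents.inner_nonneg {Φ : ∀ k, X → V k} (hΦ : ∀ k, Continuous (Φ k))
    (hpos : ∀ k x y, 0 ≤ inner ℝ (Φ k x) (Φ k y)) {μ ν : Measure X} [IsFiniteMeasure μ]
    [IsFiniteMeasure ν] {x y : lp V 2} (hx : Represents Φ μ x) (hy : Represents Φ ν y) :
    0 ≤ inner ℝ x y := by
  rw [lp.inner_eq_tsum]
  refine tsum_nonneg fun k => ?_
  rw [hx k, hy k, inner_integral_integral (hΦ k)]
  exact integral_nonneg fun _ => integral_nonneg fun _ => hpos _ _ _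

/-- A part of a represented measure is represented, and so is the rest. -/
theorem Represents.exists_restrict {Φ : ∀ k, X → V k} (hΦ : ∀ k, Continuous (Φ k))
    (hpos : ∀ k x y, 0 ≤ inner ℝ (Φ k x) (Φ k y)) {μ : Measure X} [IsFiniteMeasure μ]
    {x : lp V 2} (hx : Represents Φ μ x) {A : Set X} (hA : MeasurableSet A) :
    ∃ y z : lp V 2, Represents Φ (μ.restrict A) y ∧ Represents Φ (μ.restrict Aᶜ) z ∧
      x = y + z := by
  have hfin : seriesEnergy Φ μ ≠ ⊤ := by
    rw [hx.seriesEnergy_eq hΦ hpos]; exact ENNReal.ofReal_ne_top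
  have hr : ∀ B : Set X, ∃ y : lp V 2, Represents Φ (μ.restrict B) y := fun B =>
    exists_represents hΦ hpos (ne_top_of_le_ne_top hfin (seriesEnergy_mono Measure.restrict_le_self))
  obtain ⟨y, hy⟩ := hr A
  obtain ⟨z, hz⟩ := hr Aᶜ
  refine ⟨y, z, hy, hz, ?_⟩
  have h := hy.add hΦ hz
  rw [Measure.restrict_add_restrict_compl hA] at h
  exact lp.ext (funext fun k => (hx k).trans (h k).symm)

theorem convex_setOf_represents {Φ : ∀ k, X → V k} (hΦ : ∀ k, Continuous (Φ k)) :
    Convex ℝ {x : lp V 2 | ∃ μ : Measure X, IsFiniteMeasure μ ∧ Represents Φ μ x} := by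
  rintro x ⟨μ, hμ, hx⟩ y ⟨ν, hν, hy⟩ a b ha hb -
  have : IsFiniteMeasure (ENNReal.ofReal a • μ) := μ.smul_finite ENNReal.ofReal_ne_top
  have : IsFiniteMeasure (ENNReal.ofReal b • ν) := ν.smul_finite ENNReal.ofReal_ne_top
  exact ⟨_, inferInstance, (hx.smul ha).add hΦ (hy.smul hb)⟩

/-- The positive part with respect to the cone of measures of finite energy. -/
theorem exists_positivePart {Φ : ∀ k, X → V k} (hΦ : ∀ k, Continuous (Φ k))
    (hpos : ∀ k x y, 0 ≤ inner ℝ (Φ k x) (Φ k y)) (f : lp V 2) :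
    ∃ p : lp V 2, ‖p‖ ≤ ‖f‖ ∧ ∀ (μ : Measure X) [IsFiniteMeasure μ] (x : lp V 2),
      Represents Φ μ x → 0 ≤ inner ℝ p x ∧ inner ℝ f x ≤ inner ℝ p x := by
  obtain ⟨p, hp, h⟩ := exists_positivePart_of_cone
    (P := {x : lp V 2 | ∃ μ : Measure X, IsFiniteMeasure μ ∧ Represents Φ μ x})
    ⟨0, inferInstance, represents_zero Φ⟩
    (fun x ⟨μ, hμ, hx⟩ y ⟨ν, hν, hy⟩ => ⟨μ + ν, inferInstance, hx.add hΦ hy⟩)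
    (convex_setOf_represents hΦ)
    (fun x ⟨μ, hμ, hx⟩ y ⟨ν, hν, hy⟩ => hx.inner_nonneg hΦ hpos hy) f
  exact ⟨p, hp, fun μ hμ x hx => h x ⟨μ, hμ, hx⟩⟩

end Energy

/-- A decreasing sequence of convex sets of a Hilbert space that all meet a fixed ball have closures
with a common point in that ball. -/
theorem exists_mem_iInter_closure_of_antitone {H : Type*} [NormedAddCommGroup H]
    [InnerProductSpace ℝ H] [CompleteSpace H] {D : ℕ → Set H} (hD : Antitone D)
    (hconv : ∀ j, Convex ℝ (D j)) {R : ℝ} (hR : ∀ j, ∃ h ∈ D j, ‖h‖ ^ 2 ≤ R) :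
    ∃ p : H, ‖p‖ ^ 2 ≤ R ∧ ∀ j, p ∈ closure (D j) := by
  have hne : ∀ j, (D j).Nonempty := fun j => let ⟨h, hh, _⟩ := hR j; ⟨h, hh⟩
  choose p hp hin using fun j => exists_forall_le_inner_of_convex (hne j) (hconv j)
  have hin' : ∀ j, ∀ x ∈ closure (D j), ‖p j‖ ^ 2 ≤ inner ℝ (p j) x := fun j x hx =>
    closure_minimal (t := {z : H | ‖p j‖ ^ 2 ≤ inner ℝ (p j) z}) (hin j)
      (isClosed_le continuous_const (by fun_prop)) hx
  have hmem : ∀ j k, j ≤ k → p k ∈ closure (D j) := fun j k hjk => closure_mono (hD hjk) (hp k)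
  have hle : ∀ j, ∀ x ∈ closure (D j), ‖p j‖ ^ 2 ≤ ‖x‖ ^ 2 := fun j x hx => by
    have h1 := hin' j x hx
    have h2 := real_inner_le_norm (p j) x
    have h3 : ‖p j‖ ≤ ‖x‖ := by
      by_contra! hlt
      nlinarith [norm_nonneg x, norm_nonneg (p j)]
    gcongr
  have hbound : ∀ j, ‖p j‖ ^ 2 ≤ R := fun j => by
    obtain ⟨h, hh, hhR⟩ := hR j
    exact (hle j h (subset_closure hh)).trans hhR
  have hmono : Monotone fun j => ‖p j‖ ^ 2 := fun j k hjk => hle j _ (hmem j k hjk)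
  have hlim := tendsto_atTop_ciSup hmono ⟨R, by rintro _ ⟨j, rfl⟩; exact hbound j⟩
  have hcauchy : CauchySeq p := by
    rw [Metric.cauchySeq_iff']
    intro ε hε
    obtain ⟨N, hN⟩ := (Metric.cauchySeq_iff'.1 hlim.cauchySeq) (ε ^ 2) (by positivity)
    refine ⟨N, fun k hk => ?_⟩
    have h1 := hN k hk
    rw [Real.dist_eq] at h1
    have h2 := lt_of_le_of_lt (le_abs_self _) h1
    -- The variational inequality yields `‖p k - p N‖² ≤ ‖p k‖² - ‖p N‖²`, so convergence of the
    -- norms forces convergence of the points.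
    have h3 := hin' N (p k) (hmem N k hk)
    have h4 : ‖p k - p N‖ ^ 2 < ε ^ 2 := by
      rw [norm_sub_sq_real, real_inner_comm]
      linarith
    rw [dist_eq_norm]
    exact lt_of_pow_lt_pow_left₀ 2 hε.le h4
  obtain ⟨q, hq⟩ := cauchySeq_tendsto_of_complete hcauchy
  refine ⟨q, le_of_tendsto (hq.norm.pow 2) (Eventually.of_forall hbound), fun j => ?_⟩
  exact isClosed_closure.mem_of_tendsto hq ((eventually_ge_atTop j).mono fun k hk => hmem j k hk)

/-! ### Duality between least energy and potentials at least one -/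

section Dominators

variable {X : Type*} [TopologicalSpace X] [CompactSpace X] [T2Space X]
  [SecondCountableTopology X] [MeasurableSpace X] [BorelSpace X]
variable {V : ℕ → Type*} [∀ k, NormedAddCommGroup (V k)] [∀ k, InnerProductSpace ℝ (V k)]
  [∀ k, CompleteSpace (V k)]

/-- The least energy of a probability measure with support in `E`. -/
noncomputable def minEnergy (Φ : ∀ k, X → V k) (E : Set X) : ℝ≥0∞ :=
  ⨅ (μ : ProbabilityMeasure X) (_ : (μ : Measure X).support ⊆ E), seriesEnergy Φ (μ : Measure X)

/-- The vectors whose potential is at least `1` on `O`, in the sense of integration against the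
measures of finite energy carried by `O`. -/
def dominators (Φ : ∀ k, X → V k) (O : Set X) : Set (lp V 2) :=
  {h | ∀ (μ : Measure X) [IsFiniteMeasure μ] (x : lp V 2), μ Oᶜ = 0 → Represents Φ μ x →
    μ.real Set.univ ≤ inner ℝ h x}

theorem minEnergy_antitone (Φ : ∀ k, X → V k) : Antitone (minEnergy Φ) := fun _ _ h =>
  le_iInf₂ fun μ hμ => iInf₂_le μ (hμ.trans h)

theorem dominators_antitone (Φ : ∀ k, X → V k) : Antitone (dominators Φ) :=
  fun _ _ h _ hh μ _ x hμ hx =>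
    hh μ x (measure_mono_null (Set.compl_subset_compl.2 h) hμ) hx

theorem convex_dominators (Φ : ∀ k, X → V k) (O : Set X) : Convex ℝ (dominators Φ O) := by
  intro h hh g hg a b ha hb hab μ _ x hμ hx
  rw [inner_add_left, real_inner_smul_left, real_inner_smul_left]
  have h1 := mul_le_mul_of_nonneg_left (hh μ x hμ hx) ha
  have h2 := mul_le_mul_of_nonneg_left (hg μ x hμ hx) hb
  have h3 : a * μ.real Set.univ + b * μ.real Set.univ = μ.real Set.univ := by
    rw [← add_mul, hab, one_mul]
  linarith

/-- The easy half of the duality, by Cauchy–Schwarz: `1 ≤ ⟪h, x⟫ ≤ ‖h‖ ‖x‖` for a probability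
measure represented by `x`. -/
theorem le_minEnergy_of_mem_dominators {Φ : ∀ k, X → V k} (hΦ : ∀ k, Continuous (Φ k))
    (hpos : ∀ k x y, 0 ≤ inner ℝ (Φ k x) (Φ k y)) {O : Set X} {v : ℝ} (hv : 0 ≤ v) {h : lp V 2}
    (hh : h ∈ dominators Φ O) (hhv : ‖h‖ ^ 2 * v ≤ 1) : ENNReal.ofReal v ≤ minEnergy Φ O := by
  refine le_iInf₂ fun μ hμ => ?_
  by_cases hfin : seriesEnergy Φ (μ : Measure X) = ⊤
  · rw [hfin]; exact le_top
  obtain ⟨x, hx⟩ := exists_represents hΦ hpos hfin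
  rw [hx.seriesEnergy_eq hΦ hpos]
  refine ENNReal.ofReal_le_ofReal ?_
  have h1 := hh (μ : Measure X) x
    (measure_mono_null (Set.compl_subset_compl.2 hμ) Measure.measure_compl_support) hx
  rw [probReal_univ] at h1
  have h2 := h1.trans (real_inner_le_norm h x)
  have h3 : 1 ≤ ‖h‖ ^ 2 * ‖x‖ ^ 2 := by
    rw [← mul_pow]; exact one_le_pow₀ h2
  have h4 : 0 < ‖h‖ ^ 2 := by
    by_contra! h0
    nlinarith [sq_nonneg ‖x‖]
  nlinarith

/-- A vector that is nonnegative on the cone of measures dominates on a set as soon as it does on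
subsets carrying almost all the mass. -/
theorem le_inner_of_forall_subset {Φ : ∀ k, X → V k} (hΦ : ∀ k, Continuous (Φ k))
    (hpos : ∀ k x y, 0 ≤ inner ℝ (Φ k x) (Φ k y)) {h : lp V 2}
    (h0 : ∀ (μ : Measure X) [IsFiniteMeasure μ] (x : lp V 2), Represents Φ μ x → 0 ≤ inner ℝ h x)
    {μ : Measure X} [IsFiniteMeasure μ] {x : lp V 2} (hx : Represents Φ μ x) {A : Set X}
    (hA : MeasurableSet A)
    (hle : ∀ y, Represents Φ (μ.restrict A) y → μ.real A ≤ inner ℝ h y) :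
    μ.real A ≤ inner ℝ h x := by
  obtain ⟨y, z, hy, hz, rfl⟩ := hx.exists_restrict hΦ hpos hA
  rw [inner_add_right]
  linarith [hle y hy, h0 _ z hz]

/-- The other half of the duality: the rescaled least-norm vector of the probability measures
supported in `O` has potential at least `1` against each of them. Its positive part keeps this and
is also nonnegative on the whole cone, which is what allows passing from measures supported in `O`
to measures merely carried by `O`. -/
theorem exists_mem_dominators {Φ : ∀ k, X → V k} (hΦ : ∀ k, Continuous (Φ k))
    (hpos : ∀ k x y, 0 ≤ inner ℝ (Φ k x) (Φ k y)) {O : Set X} (hO : IsOpen O) {v : ℝ} (hv : 0 < v)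
    (hle : ENNReal.ofReal v ≤ minEnergy Φ O) : ∃ h ∈ dominators Φ O, ‖h‖ ^ 2 ≤ v⁻¹ := by
  set S : Set (lp V 2) := {x | ∃ μ : Measure X, IsProbabilityMeasure μ ∧ μ.support ⊆ O ∧
    Represents Φ μ x}
  have hSconv : Convex ℝ S := by
    rintro x ⟨μ, hμ, hμO, hx⟩ y ⟨ν, hν, hνO, hy⟩ a b ha hb hab
    have : IsFiniteMeasure (ENNReal.ofReal a • μ) := μ.smul_finite ENNReal.ofReal_ne_top
    have : IsFiniteMeasure (ENNReal.ofReal b • ν) := ν.smul_finite ENNReal.ofReal_ne_top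
    refine ⟨ENNReal.ofReal a • μ + ENNReal.ofReal b • ν, ⟨?_⟩, ?_, (hx.smul ha).add hΦ (hy.smul hb)⟩
    · simp [← ENNReal.ofReal_add ha hb, hab]
    · rw [Measure.support_add]
      refine Set.union_subset ?_ ?_
      · exact (Measure.AbsolutelyContinuous.support_mono (Measure.smul_absolutelyContinuous)).trans hμO
      · exact (Measure.AbsolutelyContinuous.support_mono (Measure.smul_absolutelyContinuous)).trans hνO
  have hSv : ∀ x ∈ S, v ≤ ‖x‖ ^ 2 := by
    rintro x ⟨μ, hμ, hμO, hx⟩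
    have h1 : minEnergy Φ O ≤ seriesEnergy Φ μ := iInf₂_le (⟨μ, hμ⟩ : ProbabilityMeasure X) hμO
    rw [hx.seriesEnergy_eq hΦ hpos] at h1
    exact (ENNReal.ofReal_le_ofReal_iff (by positivity)).1 (hle.trans h1)
  obtain ⟨h₁, hh₁, hS₁⟩ : ∃ h : lp V 2, ‖h‖ ^ 2 ≤ v⁻¹ ∧ ∀ x ∈ S, 1 ≤ inner ℝ h x := by
    -- No probability measure of finite energy need be supported in `O`; the condition is then void
    -- and zero serves.
    rcases S.eq_empty_or_nonempty with hemp | hne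
    · exact ⟨0, by simp [hv.le], by simp [hemp]⟩
    · obtain ⟨p, hp, hin⟩ := exists_forall_le_inner_of_convex hne hSconv
      have hpv : v ≤ ‖p‖ ^ 2 := closure_minimal (t := {z : lp V 2 | v ≤ ‖z‖ ^ 2}) hSv
        (isClosed_le continuous_const (by fun_prop)) hp
      have hp0 : 0 < ‖p‖ ^ 2 := hv.trans_le hpv
      -- This scaling turns `‖p‖² ≤ ⟪p, x⟫` into a pairing at least `1`, with squared norm `1 / ‖p‖²
      -- ≤ 1 / v`.
      refine ⟨(‖p‖ ^ 2)⁻¹ • p, ?_, fun x hx => ?_⟩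
      · rw [norm_smul, mul_pow, norm_inv, Real.norm_of_nonneg hp0.le, sq (‖p‖ ^ 2)⁻¹, mul_assoc,
          inv_mul_cancel₀ hp0.ne', mul_one]
        exact inv_anti₀ hv hpv
      · rw [real_inner_smul_left, ← inv_mul_cancel₀ hp0.ne']
        exact mul_le_mul_of_nonneg_left (hin x hx) (by positivity)
  obtain ⟨h, hh, hdom⟩ := exists_positivePart hΦ hpos h₁
  refine ⟨h, fun μ _ x hμ hx => ?_, le_trans (by gcongr) hh₁⟩
  -- A measure null off `O` may have closed support leaving `O`. Its normalised restriction to a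
  -- compact `K ⊆ O` does lie in `S`, and inner regularity recovers `O`.
  have hK : ∀ K ⊆ O, IsCompact K → μ.real K ≤ inner ℝ h x := fun K hKO hKc => by
    refine le_inner_of_forall_subset hΦ hpos (fun μ _ x hx => (hdom μ x hx).1) hx
      hKc.measurableSet fun y hy => ?_
    rcases (measureReal_nonneg : 0 ≤ μ.real K).eq_or_lt with h0 | h0
    · rw [← h0]; exact (hdom _ y hy).1
    · have hmem : (μ.real K)⁻¹ • y ∈ S := by
        refine ⟨_, ⟨?_⟩, ?_, hy.smul (inv_nonneg.2 h0.le)⟩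
        · rw [Measure.smul_apply, Measure.restrict_apply_univ, smul_eq_mul,
            ENNReal.ofReal_inv_of_pos h0, ofReal_measureReal]
          exact ENNReal.inv_mul_cancel (fun h => by simp [Measure.real, h] at h0)
            (measure_ne_top μ K)
        · refine (Measure.AbsolutelyContinuous.support_mono
            Measure.smul_absolutelyContinuous).trans ?_
          refine Measure.support_restrict_subset.trans (Set.inter_subset_left.trans ?_)
          rwa [hKc.isClosed.closure_eq]
      have h1 := hS₁ _ hmem
      rw [real_inner_smul_right] at h1
      have h2 := mul_le_mul_of_nonneg_left h1 h0.le
      rw [mul_one, mul_inv_cancel_left₀ h0.ne'] at h2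
      exact h2.trans (hdom _ y hy).2
  have huniv : μ Set.univ = μ O := by
    rw [← measure_add_measure_compl hO.measurableSet, hμ, add_zero]
  have hfinal : μ O ≤ ENNReal.ofReal (inner ℝ h x) := by
    rw [hO.measure_eq_iSup_isCompact]
    refine iSup₂_le fun K hKO => iSup_le fun hKc => ?_
    rw [← ofReal_measureReal]
    exact ENNReal.ofReal_le_ofReal (hK K hKO hKc)
  rw [Measure.real, huniv]
  exact ENNReal.toReal_le_of_le_ofReal (hdom μ x hx).1 hfinal

/-- A measure carried by `A ∪ B` splits into its restriction to `A` and a remainder carried by `B`.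
-/
theorem mem_dominators_union {Φ : ∀ k, X → V k} (hΦ : ∀ k, Continuous (Φ k))
    (hpos : ∀ k x y, 0 ≤ inner ℝ (Φ k x) (Φ k y)) {A B : Set X} (hA : MeasurableSet A)
    {h : lp V 2} (hhA : h ∈ dominators Φ A) (hhB : h ∈ dominators Φ B) :
    h ∈ dominators Φ (A ∪ B) := by
  intro μ _ x hμ hx
  obtain ⟨y, z, hy, hz, rfl⟩ := hx.exists_restrict hΦ hpos hA
  have h1 := hhA _ y (by rw [Measure.restrict_apply hA.compl]; simp) hy
  have h2 := hhB _ z (by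
    rw [Measure.restrict_apply' hA.compl]
    exact measure_mono_null (fun t ht => by simp_all) hμ) hz
  rw [measureReal_restrict_apply_univ] at h1 h2
  rw [inner_add_right, ← measureReal_add_measureReal_compl hA]
  linarith

/-- Finite unions carry almost all the mass, and nonnegativity of `h` on the cone lets the rest be
dropped. -/
theorem mem_dominators_iUnion {Φ : ∀ k, X → V k} (hΦ : ∀ k, Continuous (Φ k))
    (hpos : ∀ k x y, 0 ≤ inner ℝ (Φ k x) (Φ k y)) {O : ℕ → Set X}
    (hO : ∀ j, MeasurableSet (O j)) {h : lp V 2}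
    (h0 : ∀ (μ : Measure X) [IsFiniteMeasure μ] (x : lp V 2), Represents Φ μ x → 0 ≤ inner ℝ h x)
    (hh : ∀ j, h ∈ dominators Φ (O j)) : h ∈ dominators Φ (⋃ j, O j) := by
  have hmeas : ∀ n, MeasurableSet (Set.accumulate O n) := fun n =>
    MeasurableSet.biUnion (Set.to_countable _) fun j _ => hO j
  have hacc : ∀ n, h ∈ dominators Φ (Set.accumulate O n) := by
    intro n
    induction n with
    | zero => simpa [Set.accumulate_zero_nat] using hh 0
    | succ n ih =>
      rw [Set.accumulate_succ]
      exact mem_dominators_union hΦ hpos (hmeas n) ih (hh _)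
  intro μ _ x hμ hx
  have huniv : μ.real Set.univ = μ.real (⋃ j, O j) := by
    rw [← measureReal_add_measureReal_compl (MeasurableSet.iUnion hO), Measure.real, Measure.real,
      hμ]
    simp
  rw [huniv]
  have hlim := (ENNReal.tendsto_toReal (measure_ne_top μ _)).comp
    (tendsto_measure_iUnion_accumulate (μ := μ) (f := O))
  refine le_of_tendsto hlim (Eventually.of_forall fun n => ?_)
  refine le_inner_of_forall_subset hΦ hpos h0 hx (hmeas n) fun y hy => ?_
  have h1 := hacc n _ y (by rw [Measure.restrict_apply (hmeas n).compl]; simp) hy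
  rwa [measureReal_restrict_apply_univ] at h1

end Dominators

/-! ### Outer least energy: increasing unions and compact sets -/

section OuterEnergy

variable {X : Type*} [TopologicalSpace X] [CompactSpace X] [T2Space X]
  [SecondCountableTopology X] [MeasurableSpace X] [BorelSpace X]
variable {V : ℕ → Type*} [∀ k, NormedAddCommGroup (V k)] [∀ k, InnerProductSpace ℝ (V k)]
  [∀ k, CompleteSpace (V k)]

/-- The outer version of `minEnergy`. -/
noncomputable def outerMinEnergy (Φ : ∀ k, X → V k) (E : Set X) : ℝ≥0∞ :=
  ⨆ O : {O : Set X // IsOpen O ∧ E ⊆ O}, minEnergy Φ O.1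

theorem outerMinEnergy_antitone (Φ : ∀ k, X → V k) : Antitone (outerMinEnergy Φ) :=
  fun _ _ h => iSup_le fun O => le_iSup (fun O : {O : Set X // IsOpen O ∧ _ ⊆ O} => minEnergy Φ O.1)
    ⟨O.1, O.2.1, h.trans O.2.2⟩

theorem outerMinEnergy_iUnion {Φ : ∀ k, X → V k} (hΦ : ∀ k, Continuous (Φ k))
    (hpos : ∀ k x y, 0 ≤ inner ℝ (Φ k x) (Φ k y)) {E : ℕ → Set X} (hE : Monotone E) :
    outerMinEnergy Φ (⋃ j, E j) = ⨅ j, outerMinEnergy Φ (E j) := by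
  refine le_antisymm (le_iInf fun j => outerMinEnergy_antitone Φ (Set.subset_iUnion E j)) ?_
  refine le_of_forall_lt fun a ha => ?_
  obtain ⟨v, hav, hv⟩ := ENNReal.lt_iff_exists_nnreal_btwn.1 ha
  -- The gap between `u` and `v` pays for the excess `ε` in the norm of the final dominator.
  obtain ⟨u, hau, huv⟩ := ENNReal.lt_iff_exists_nnreal_btwn.1 hav
  refine hau.trans_le ?_
  have huv' : (u : ℝ) < v := by exact_mod_cast huv
  have hv0 : (0 : ℝ) < v := u.2.trans_lt huv'
  set D : ℕ → Set (lp V 2) := fun j => {h | ∃ O, IsOpen O ∧ E j ⊆ O ∧ h ∈ dominators Φ O}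
  have hDanti : Antitone D := fun i j hij h ⟨O, hO, hEO, hh⟩ => ⟨O, hO, (hE hij).trans hEO, hh⟩
  -- Two vectors dominating on different neighbourhoods both dominate on the intersection, still a
  -- neighbourhood of `E j`.
  have hDconv : ∀ j, Convex ℝ (D j) := by
    rintro j h ⟨O, hO, hEO, hh⟩ g ⟨U, hU, hEU, hg⟩ a b ha hb hab
    exact ⟨O ∩ U, hO.inter hU, Set.subset_inter hEO hEU, convex_dominators Φ _
      (dominators_antitone Φ Set.inter_subset_left hh)
      (dominators_antitone Φ Set.inter_subset_right hg) ha hb hab⟩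
  have hDv : ∀ j, ∃ h ∈ D j, ‖h‖ ^ 2 ≤ (v : ℝ)⁻¹ := fun j => by
    obtain ⟨O, hO⟩ := lt_iSup_iff.1 (hv.trans_le (iInf_le _ j))
    obtain ⟨h, hh, hhv⟩ := exists_mem_dominators hΦ hpos O.2.1 hv0
      (by rw [ENNReal.ofReal_coe_nnreal]; exact hO.le)
    exact ⟨h, ⟨O, O.2.1, O.2.2, hh⟩, hhv⟩
  obtain ⟨p, hpv, hp⟩ := exists_mem_iInter_closure_of_antitone hDanti hDconv hDv
  obtain ⟨ε, hε0, hε⟩ : ∃ ε : ℝ, 0 < ε ∧ (‖p‖ + ε) ^ 2 * u ≤ 1 := by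
    have hlt : (‖p‖ + 0) ^ 2 * u < 1 := by
      rw [add_zero]
      calc ‖p‖ ^ 2 * u ≤ (v : ℝ)⁻¹ * u := by gcongr
        _ < (v : ℝ)⁻¹ * v := by gcongr
        _ = 1 := inv_mul_cancel₀ hv0.ne'
    have hcont : Continuous fun ε : ℝ => (‖p‖ + ε) ^ 2 * u := by fun_prop
    have hev : ∀ᶠ ε in 𝓝[>] (0 : ℝ), (‖p‖ + ε) ^ 2 * u < 1 :=
      (hcont.tendsto 0).mono_left nhdsWithin_le_nhds (Iio_mem_nhds hlt)
    obtain ⟨ε, h1, h2⟩ := (hev.and self_mem_nhdsWithin).exists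
    exact ⟨ε, h2, h1.le⟩
  have hδ : ∀ j : ℕ, 0 < ε / 2 / 2 ^ j := fun j => by positivity
  choose h hhD hhp using fun j => Metric.mem_closure_iff.1 (hp j) _ (hδ j)
  choose O hO hEO hhO using hhD
  obtain ⟨p', hp'p, hp'⟩ := exists_positivePart hΦ hpos p
  -- On the cone, `h j = p + (h j - p)` is at most `p' + q j`, hence at most `p' + ∑ q`, because
  -- every `q i` is nonnegative there.
  choose q hqh hq using fun j => exists_positivePart hΦ hpos (h j - p)
  have hqle : ∀ j, ‖q j‖ ≤ ε / 2 / 2 ^ j := fun j =>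
    (hqh j).trans (by rw [← dist_eq_norm, dist_comm]; exact (hhp j).le)
  have hgeom : HasSum (fun j : ℕ => ε / 2 / 2 ^ j) ε := hasSum_geometric_two' ε
  have hqs : Summable q := Summable.of_norm_bounded hgeom.summable hqle
  have hgle : ‖p' + ∑' j, q j‖ ≤ ‖p‖ + ε :=
    (norm_add_le _ _).trans (add_le_add hp'p (tsum_of_norm_bounded hgeom hqle))
  have hinner : ∀ x, HasSum (fun j => inner ℝ (q j) x) (inner ℝ (∑' j, q j) x) := fun x => by
    have := hqs.hasSum.mapL (innerSL ℝ x)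
    simpa [real_inner_comm] using this
  have hg0 : ∀ (μ : Measure X) [IsFiniteMeasure μ] (x : lp V 2), Represents Φ μ x →
      0 ≤ inner ℝ (p' + ∑' j, q j) x := fun μ _ x hx => by
    rw [inner_add_left]
    exact add_nonneg (hp' μ x hx).1 ((hinner x).nonneg fun j => (hq j μ x hx).1)
  have hg : ∀ j, p' + ∑' j, q j ∈ dominators Φ (O j) := fun j μ _ x hμ hx => by
    have h1 := hhO j μ x hμ hx
    have h2 := (hp' μ x hx).2
    have h3 := (hq j μ x hx).2
    have h4 := le_hasSum (hinner x) j fun i _ => (hq i μ x hx).1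
    rw [inner_sub_left] at h3
    rw [inner_add_left]
    linarith
  have hmem := mem_dominators_iUnion hΦ hpos (fun j => (hO j).measurableSet) hg0 hg
  rw [← ENNReal.ofReal_coe_nnreal]
  refine (le_minEnergy_of_mem_dominators hΦ hpos u.2 hmem (le_trans ?_ hε)).trans
    (le_iSup (fun O : {O : Set X // IsOpen O ∧ _ ⊆ O} => minEnergy Φ O.1)
      ⟨⋃ j, O j, isOpen_iUnion hO, Set.iUnion_mono hEO⟩)
  exact mul_le_mul_of_nonneg_right (pow_le_pow_left₀ (norm_nonneg _) hgle 2) u.2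

/-- Lower semicontinuity of the energy. -/
theorem seriesEnergy_le_of_tendsto {Φ : ∀ k, X → V k} (hΦ : ∀ k, Continuous (Φ k))
    (hpos : ∀ k x y, 0 ≤ inner ℝ (Φ k x) (Φ k y)) {μs : ℕ → ProbabilityMeasure X}
    {μ : ProbabilityMeasure X} (hμ : Tendsto μs atTop (𝓝 μ)) {s : ℕ → ℝ} {S : ℝ}
    (hs : Tendsto s atTop (𝓝 S)) (hs0 : ∀ j, 0 ≤ s j)
    (hle : ∀ j, seriesEnergy Φ (μs j : Measure X) ≤ ENNReal.ofReal (s j)) :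
    seriesEnergy Φ (μ : Measure X) ≤ ENNReal.ofReal S := by
  rw [seriesEnergy_eq hΦ hpos]
  refine ENNReal.tsum_le_of_sum_range_le fun N => ?_
  rw [← ENNReal.ofReal_sum_of_nonneg fun k _ => by positivity]
  refine ENNReal.ofReal_le_ofReal ?_
  -- Weak convergence is tested only on scalar functions. The bound `2⟪a, b⟫ - ‖a‖² ≤ ‖b‖²`, with
  -- `a` the limit moment, is affine in `b` and sharp at `b = a`.
  have hlim : ∀ k, Tendsto (fun j => 2 * inner ℝ (∫ x, Φ k x ∂(μ : Measure X))
      (∫ x, Φ k x ∂(μs j : Measure X)) - ‖∫ x, Φ k x ∂(μ : Measure X)‖ ^ 2) atTop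
      (𝓝 (‖∫ x, Φ k x ∂(μ : Measure X)‖ ^ 2)) := fun k => by
    have hk := hΦ k
    have h1 := (ProbabilityMeasure.tendsto_iff_forall_integral_tendsto.1 hμ)
      (BoundedContinuousFunction.mkOfCompact
        ⟨fun y => inner ℝ (∫ x, Φ k x ∂(μ : Measure X)) (Φ k y), by fun_prop⟩)
    simp only [BoundedContinuousFunction.mkOfCompact_apply, ContinuousMap.coe_mk] at h1
    simp only [integral_inner (integrable_of_continuous hk _)] at h1
    have h2 := (h1.const_mul 2).sub_const (‖∫ x, Φ k x ∂(μ : Measure X)‖ ^ 2)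
    rw [real_inner_self_eq_norm_sq] at h2
    convert h2 using 2
    ring
  refine le_of_tendsto_of_tendsto' (tendsto_finsetSum _ fun k _ => hlim k) hs fun j => ?_
  have h3 : ∑ k ∈ Finset.range N, ‖∫ x, Φ k x ∂(μs j : Measure X)‖ ^ 2 ≤ s j := by
    have h4 := hle j
    rw [seriesEnergy_eq hΦ hpos] at h4
    have h5 := (ENNReal.sum_le_tsum (Finset.range N)).trans h4
    rw [← ENNReal.ofReal_sum_of_nonneg fun k _ => by positivity] at h5
    exact (ENNReal.ofReal_le_ofReal_iff (hs0 j)).1 h5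
  refine le_trans (Finset.sum_le_sum fun k _ => ?_) h3
  have h6 := norm_sub_sq_real (∫ x, Φ k x ∂(μ : Measure X)) (∫ x, Φ k x ∂(μs j : Measure X))
  nlinarith [sq_nonneg ‖(∫ x, Φ k x ∂(μ : Measure X)) - ∫ x, Φ k x ∂(μs j : Measure X)‖]

/-- Near-minimisers on shrinking thickenings of `K` have a weak limit point, which is carried by
`K`; the energy is lower semicontinuous. -/
theorem outerMinEnergy_of_isCompact {Φ : ∀ k, X → V k} (hΦ : ∀ k, Continuous (Φ k))
    (hpos : ∀ k x y, 0 ≤ inner ℝ (Φ k x) (Φ k y)) {K : Set X} (hK : IsCompact K) :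
    outerMinEnergy Φ K = minEnergy Φ K := by
  refine le_antisymm (iSup_le fun O => minEnergy_antitone Φ O.2.2) ?_
  rcases eq_or_ne (outerMinEnergy Φ K) ⊤ with htop | htop
  · rw [htop]; exact le_top
  let _ : MetricSpace X := TopologicalSpace.metrizableSpaceMetric X
  let δ : ℕ → ℝ := fun j => 1 / ((j : ℝ) + 1)
  have hδ0 : ∀ j, 0 < δ j := fun j => Nat.one_div_pos_of_nat
  have hδ : Tendsto δ atTop (𝓝 0) := tendsto_one_div_add_atTop_nhds_zero_nat
  set S := (outerMinEnergy Φ K).toReal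
  have hex : ∀ j, ∃ μ : ProbabilityMeasure X, (μ : Measure X).support ⊆ Metric.thickening (δ j) K ∧
      seriesEnergy Φ (μ : Measure X) ≤ ENNReal.ofReal (S + δ j) := fun j => by
    have h1 : minEnergy Φ (Metric.thickening (δ j) K) < ENNReal.ofReal (S + δ j) := by
      refine lt_of_le_of_lt (le_iSup (fun O : {O : Set X // IsOpen O ∧ K ⊆ O} => minEnergy Φ O.1)
        ⟨_, Metric.isOpen_thickening, Metric.self_subset_thickening (hδ0 j) K⟩) ?_
      change outerMinEnergy Φ K < _
      rw [← ENNReal.ofReal_toReal htop]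
      exact (ENNReal.ofReal_lt_ofReal_iff (add_pos_of_nonneg_of_pos ENNReal.toReal_nonneg (hδ0 j))).2
        (lt_add_of_pos_right _ (hδ0 j))
    obtain ⟨μ, h2⟩ := iInf_lt_iff.1 h1
    obtain ⟨h3, h4⟩ := iInf_lt_iff.1 h2
    exact ⟨μ, h3, h4.le⟩
  choose μs hsupp hen using hex
  obtain ⟨μ, φ, hφ, hlim⟩ := CompactSpace.tendsto_subseq μs
  have hφδ : Tendsto (fun j => δ (φ j)) atTop (𝓝 0) := hδ.comp hφ.tendsto_atTop
  have henergy : seriesEnergy Φ (μ : Measure X) ≤ ENNReal.ofReal S := by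
    refine seriesEnergy_le_of_tendsto hΦ hpos hlim (s := fun j => S + δ (φ j)) ?_
      (fun j => add_nonneg ENNReal.toReal_nonneg (hδ0 _).le) fun j => hen (φ j)
    simpa using hφδ.const_add S
  -- The complement of each closed thickening is open and eventually null along the subsequence,
  -- hence null for the limit; these sets exhaust `Kᶜ`.
  have hnull : (μ : Measure X) Kᶜ = 0 := by
    have hKc : Kᶜ = ⋃ i, (Metric.cthickening (δ i) K)ᶜ := by
      rw [← Set.compl_iInter, compl_inj_iff]
      refine Set.Subset.antisymm (Set.subset_iInter fun i => Metric.self_subset_cthickening K)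
        fun x hx => ?_
      rw [← hK.isClosed.closure_eq, ← Metric.cthickening_zero, Metric.mem_cthickening_iff,
        ENNReal.ofReal_zero]
      refine ge_of_tendsto (x := atTop) (f := fun i => ENNReal.ofReal (δ i)) ?_
        (Eventually.of_forall fun i => Metric.mem_cthickening_iff.1 (Set.mem_iInter.1 hx i))
      simpa using ENNReal.tendsto_ofReal hδ
    rw [hKc, measure_iUnion_null_iff]
    intro i
    have h1 := ProbabilityMeasure.le_liminf_measure_open_of_tendsto hlim
      (Metric.isClosed_cthickening (δ := δ i) (E := K)).isOpen_compl
    refine le_antisymm (h1.trans (le_of_eq ?_)) zero_le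
    have h2 : ∀ᶠ j in atTop, ((μs ∘ φ) j : Measure X) (Metric.cthickening (δ i) K)ᶜ = 0 := by
      filter_upwards [hφδ (Iio_mem_nhds (hδ0 i))] with j hj
      refine measure_mono_null (Set.compl_subset_compl.2 ((hsupp (φ j)).trans
        ((Metric.thickening_mono (le_of_lt hj) K).trans
          (Metric.thickening_subset_cthickening _ _)))) Measure.measure_compl_support
    rw [liminf_congr h2, liminf_const]
  calc minEnergy Φ K ≤ seriesEnergy Φ (μ : Measure X) :=
        iInf₂_le μ (Measure.support_subset_of_isClosed hK.isClosed hnull)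
    _ ≤ ENNReal.ofReal S := henergy
    _ = outerMinEnergy Φ K := ENNReal.ofReal_toReal htop

end OuterEnergy

/-! ### Projective space and the expansion of the logarithmic kernel -/

section Projective

open scoped ComplexConjugate

variable {n : ℕ}

/-- Lagrange's identity. -/
theorem wedgeNorm_sq (v w : EuclideanSpace ℂ (Fin (n + 1))) :
    wedgeNorm v w ^ 2 = ‖v‖ ^ 2 * ‖w‖ ^ 2 - ‖∑ i, v i * conj (w i)‖ ^ 2 := by
  unfold wedgeNorm
  rw [Real.sq_sqrt (by positivity), EuclideanSpace.norm_sq_eq, EuclideanSpace.norm_sq_eq]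
  set f : Fin (n + 1) → Fin (n + 1) → ℝ := fun i j => ‖v i * w j - v j * w i‖ ^ 2 with hf
  have hs : ∀ i j, f j i = f i j := fun i j => by
    simp only [hf]; rw [← norm_neg]; congr 2; ring
  have hd : ∀ i, f i i = 0 := fun i => by simp [hf]
  have h1 : 2 * ∑ i, ∑ j ∈ Finset.Ioi i, f i j = ∑ i, ∑ j, f i j := by
    have h := Finset.sum_sum_Ioi_add_eq_sum_sum_off_diag f
    have h3 : ∀ i, ∑ j ∈ {i}ᶜ, f j i = ∑ j, f i j := fun i => by
      rw [← Finset.sum_compl_add_sum {i}, Finset.sum_singleton, hd, add_zero]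
      exact Finset.sum_congr rfl fun j _ => hs i j
    rw [← Finset.sum_congr rfl fun i _ => h3 i, ← h, Finset.mul_sum]
    refine Finset.sum_congr rfl fun i _ => ?_
    rw [Finset.mul_sum]
    exact Finset.sum_congr rfl fun j _ => by rw [hs i j, two_mul]
  have h4 : (((∑ i, ∑ j, f i j : ℝ)) : ℂ) = ((2 * ((∑ i, ‖v i‖ ^ 2) * ∑ i, ‖w i‖ ^ 2)
      - 2 * ‖∑ i, v i * conj (w i)‖ ^ 2 : ℝ) : ℂ) := by
    push_cast
    simp only [hf]
    push_cast
    simp only [← Complex.mul_conj', map_sub, map_mul, map_sum, Complex.conj_conj]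
    rw [Finset.sum_mul_sum, Finset.sum_mul_sum]
    have e : ∀ i j : Fin (n + 1), (v i * w j - v j * w i) *
        (conj (v i) * conj (w j) - conj (v j) * conj (w i))
        = (v i * conj (v i) * (w j * conj (w j)) - v i * conj (w i) * (conj (v j) * w j))
        + (v j * conj (v j) * (w i * conj (w i)) - v j * conj (w j) * (conj (v i) * w i)) :=
      fun i j => by ring
    simp only [e, Finset.sum_add_distrib, Finset.sum_sub_distrib]
    rw [Finset.sum_comm (f := fun i j => v j * conj (v j) * (w i * conj (w i))),
      Finset.sum_comm (f := fun i j => v j * conj (w j) * (conj (v i) * w i))]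
    ring
  have h5 := Complex.ofReal_injective h4
  linarith

theorem exists_mk_eq (ζ : CP n) : ∃ v hv, Projectivization.mk ℂ v hv = ζ :=
  ⟨ζ.rep, ζ.rep_nonzero, Projectivization.mk_rep ζ⟩

/-- The index set of the real coordinates of an `(n + 1) × (n + 1)` complex matrix. -/
abbrev CoordIndex (n : ℕ) : Type :=
  (Fin (n + 1) × Fin (n + 1)) ⊕ (Fin (n + 1) × Fin (n + 1))

/-- The real coordinates of the matrix `v v* / |v|²` of the orthogonal projection onto `ℂ v`. -/
noncomputable def lineCoord (v : EuclideanSpace ℂ (Fin (n + 1))) : CoordIndex n → ℝ :=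
  Sum.elim (fun p => (v p.1 * conj (v p.2)).re / ‖v‖ ^ 2)
    (fun p => (v p.1 * conj (v p.2)).im / ‖v‖ ^ 2)

theorem lineCoord_smul {a : ℂ} (ha : a ≠ 0) (v : EuclideanSpace ℂ (Fin (n + 1))) :
    lineCoord (a • v) = lineCoord v := by
  have ha' : ‖a‖ ^ 2 ≠ 0 := by simpa using ha
  have e : ∀ i j, (a • v) i * conj ((a • v) j) = ((‖a‖ ^ 2 : ℝ) : ℂ) * (v i * conj (v j)) :=
    fun i j => by
      simp only [PiLp.smul_apply, smul_eq_mul, map_mul]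
      push_cast
      rw [← Complex.mul_conj']
      ring
  unfold lineCoord
  simp only [e, Complex.re_ofReal_mul, Complex.im_ofReal_mul, norm_smul, mul_pow,
    mul_div_mul_left _ _ ha']

/-- The left side is the real trace inner product of two rank-one projections. -/
theorem sum_lineCoord_mul (v w : EuclideanSpace ℂ (Fin (n + 1))) :
    ∑ s, lineCoord v s * lineCoord w s
      = ‖∑ i, v i * conj (w i)‖ ^ 2 / (‖v‖ ^ 2 * ‖w‖ ^ 2) := by
  have h : ‖∑ i, v i * conj (w i)‖ ^ 2 = ∑ p : Fin (n + 1) × Fin (n + 1),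
      ((v p.1 * conj (v p.2)).re * (w p.1 * conj (w p.2)).re
        + (v p.1 * conj (v p.2)).im * (w p.1 * conj (w p.2)).im) := by
    have h1 : ((‖∑ i, v i * conj (w i)‖ ^ 2 : ℝ) : ℂ) = ∑ p : Fin (n + 1) × Fin (n + 1),
        v p.1 * conj (v p.2) * conj (w p.1 * conj (w p.2)) := by
      push_cast
      rw [← Complex.mul_conj', map_sum, Finset.sum_mul_sum, Fintype.sum_prod_type]
      refine Finset.sum_congr rfl fun i _ => Finset.sum_congr rfl fun j _ => ?_
      simp only [map_mul, Complex.conj_conj]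
      ring
    rw [← Complex.ofReal_re (‖∑ i, v i * conj (w i)‖ ^ 2), h1, Complex.re_sum]
    refine Finset.sum_congr rfl fun p _ => ?_
    rw [Complex.mul_re, Complex.conj_re, Complex.conj_im]
    ring
  rw [Fintype.sum_sum_type, ← Finset.sum_add_distrib, h, Finset.sum_div]
  refine Finset.sum_congr rfl fun p _ => ?_
  simp only [lineCoord, Sum.elim_inl, Sum.elim_inr]
  rw [div_mul_div_comm, div_mul_div_comm, ← add_div]

/-- The map `ζ ↦ lineCoord ζ` on projective space. -/
noncomputable def projCoord : CP n → CoordIndex n → ℝ :=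
  Projectivization.lift (fun v => lineCoord v.1) (by
    rintro ⟨a, ha⟩ ⟨b, hb⟩ t h
    change a = t • b at h
    have ht : t ≠ 0 := fun h0 => ha (by rw [h, h0, zero_smul])
    change lineCoord a = lineCoord b
    rw [h, lineCoord_smul ht])

theorem projCoord_mk (v : EuclideanSpace ℂ (Fin (n + 1))) (hv : v ≠ 0) :
    projCoord (Projectivization.mk ℂ v hv) = lineCoord v := rfl

theorem continuous_mk : Continuous fun v : {v : EuclideanSpace ℂ (Fin (n + 1)) // v ≠ 0} =>
    (Projectivization.mk ℂ v.1 v.2 : CP n) :=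
  continuous_quotient_mk'

theorem continuous_projCoord : Continuous (projCoord : CP n → CoordIndex n → ℝ) := by
  refine continuous_quot_lift _ (continuous_pi fun s => ?_)
  have hne : ∀ v : {v : EuclideanSpace ℂ (Fin (n + 1)) // v ≠ 0}, ‖v.1‖ ^ 2 ≠ 0 := fun v => by
    simpa using v.2
  rcases s with p | p
  · exact (Complex.continuous_re.comp (by fun_prop)).div (by fun_prop) hne
  · exact (Complex.continuous_im.comp (by fun_prop)).div (by fun_prop) hne

theorem wedgeRatio_nonneg (ζ η : CP n) : 0 ≤ wedgeRatio ζ η := by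
  unfold wedgeRatio wedgeNorm
  positivity

theorem sum_projCoord_mul (ζ η : CP n) :
    ∑ s, projCoord ζ s * projCoord η s = 1 - wedgeRatio ζ η ^ 2 := by
  obtain ⟨v, hv, rfl⟩ := exists_mk_eq ζ
  obtain ⟨w, hw, rfl⟩ := exists_mk_eq η
  have hv0 : ‖v‖ ≠ 0 := norm_ne_zero_iff.2 hv
  have hw0 : ‖w‖ ≠ 0 := norm_ne_zero_iff.2 hw
  rw [projCoord_mk, projCoord_mk, sum_lineCoord_mul, wedgeRatio_mk, div_pow, wedgeNorm_sq]
  field_simp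
  ring

theorem sum_projCoord_mul_nonneg (ζ η : CP n) : 0 ≤ ∑ s, projCoord ζ s * projCoord η s := by
  have h : wedgeRatio ζ η ≤ 1 := div_le_one_of_le₀ (wedgeNorm_le _ _) (by positivity)
  rw [sum_projCoord_mul, sub_nonneg]
  exact pow_le_one₀ (wedgeRatio_nonneg _ _) h

/-- Equal coordinates force `ζ ∧ η = 0`, the equality case of Cauchy–Schwarz. Injectivity embeds the
quotient in a Euclidean space, giving the Hausdorff property and, with compactness, second
countability. -/
theorem projCoord_injective : Function.Injective (projCoord : CP n → CoordIndex n → ℝ) := by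
  intro ζ η h
  have h1 : wedgeRatio ζ η = wedgeRatio ζ ζ := by
    have h2 := sum_projCoord_mul ζ η
    rw [← h, sum_projCoord_mul, sub_right_inj] at h2
    exact ((pow_left_inj₀ (wedgeRatio_nonneg _ _) (wedgeRatio_nonneg _ _) two_ne_zero).1 h2).symm
  obtain ⟨v, hv, rfl⟩ := exists_mk_eq ζ
  obtain ⟨w, hw, rfl⟩ := exists_mk_eq η
  have hv0 : ‖v‖ ≠ 0 := norm_ne_zero_iff.2 hv
  have hw0 : ‖w‖ ≠ 0 := norm_ne_zero_iff.2 hw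
  have h3 : wedgeNorm v v = 0 := by
    simp [wedgeNorm, mul_comm]
  rw [wedgeRatio_mk, wedgeRatio_mk, h3, zero_div, div_eq_zero_iff] at h1
  have h4 := wedgeNorm_sq v w
  rw [h1.resolve_right (mul_ne_zero hv0 hw0), zero_pow two_ne_zero, ← mul_pow, eq_comm,
    sub_eq_zero, eq_comm, pow_left_inj₀ (norm_nonneg _) (by positivity) two_ne_zero] at h4
  have h5 : ‖inner ℂ w v‖ = ‖w‖ * ‖v‖ := by
    rw [PiLp.inner_apply, mul_comm ‖w‖]
    simpa [RCLike.inner_apply] using h4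
  rw [norm_inner_eq_norm_iff hw hv] at h5
  obtain ⟨r, hr, hvr⟩ := h5
  exact (Projectivization.mk_eq_mk_iff' ℂ v w hv hw).2 ⟨r, hvr.symm⟩

instance instCompactSpaceCP : CompactSpace (CP n) := by
  have hsph : CompactSpace (Metric.sphere (0 : EuclideanSpace ℂ (Fin (n + 1))) 1) :=
    isCompact_iff_compactSpace.1 (isCompact_sphere _ _)
  let g : Metric.sphere (0 : EuclideanSpace ℂ (Fin (n + 1))) 1 → CP n := fun v =>
    Projectivization.mk ℂ v.1 (ne_zero_of_mem_unit_sphere v)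
  have hg : Continuous g := continuous_mk.comp
    (Continuous.subtype_mk continuous_subtype_val fun v => ne_zero_of_mem_unit_sphere v)
  refine Function.Surjective.compactSpace (f := g) hg fun ζ => ?_
  obtain ⟨v, hv, rfl⟩ := exists_mk_eq ζ
  have hv0 : ‖v‖ ≠ 0 := norm_ne_zero_iff.2 hv
  refine ⟨⟨(‖v‖⁻¹ : ℂ) • v, by simp [norm_smul, hv0]⟩, ?_⟩
  exact (Projectivization.mk_eq_mk_iff' ℂ _ _ _ _).2 ⟨_, rfl⟩

instance instT2SpaceCP : T2Space (CP n) :=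
  T2Space.of_injective_continuous projCoord_injective continuous_projCoord

instance instSecondCountableTopologyCP : SecondCountableTopology (CP n) :=
  (continuous_projCoord.isClosedEmbedding
    projCoord_injective).isEmbedding.secondCountableTopology

/-- The Hilbert-space valued maps with `⟪Φₖ ζ, Φₖ η⟫ = (1 - |ζ ∧ η|² / (|ζ|² |η|²))ᵏ⁺¹ / (2 (k + 1))`,
whose sum over `k` is the kernel `-G`. -/
noncomputable def feature (k : ℕ) (ζ : CP n) : EuclideanSpace ℝ (Fin (k + 1) → CoordIndex n) :=
  WithLp.toLp 2 fun w => (√(2 * (k + 1 : ℝ)))⁻¹ * ∏ l, projCoord ζ (w l)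

theorem continuous_feature (k : ℕ) : Continuous (feature k (n := n)) := by
  have h := continuous_projCoord (n := n)
  unfold feature
  fun_prop

theorem inner_feature (k : ℕ) (ζ η : CP n) : inner ℝ (feature k ζ) (feature k η)
    = 2⁻¹ * ((∑ s, projCoord ζ s * projCoord η s) ^ (k + 1) / (k + 1)) := by
  -- The power of the sum expands over words of length `k + 1`, which index the coordinates of the
  -- tensor power.
  rw [PiLp.inner_apply, Fintype.sum_pow, Finset.sum_div, Finset.mul_sum]
  refine Finset.sum_congr rfl fun w _ => ?_
  have h : √(2 * (k + 1 : ℝ)) ^ 2 = 2 * (k + 1 : ℝ) := Real.sq_sqrt (by positivity)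
  have h0 : √(2 * (k + 1 : ℝ)) ≠ 0 := by positivity
  simp only [feature, RCLike.inner_apply, conj_trivial, Finset.prod_mul_distrib]
  field_simp
  rw [h]

theorem inner_feature_nonneg (k : ℕ) (ζ η : CP n) :
    0 ≤ inner ℝ (feature k ζ) (feature k η) := by
  rw [inner_feature]
  have := sum_projCoord_mul_nonneg ζ η
  positivity

/-- This is `-log (1 - x) = ∑ xᵏ⁺¹ / (k + 1)` at `x = 1 - r²`, halved because `log r² = 2 log r`. At
`r = 0` it is the divergent harmonic series, matching `-log 0 = +∞`. -/
theorem tsum_inner_feature (ζ η : CP n) :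
    ∑' k, ENNReal.ofReal (inner ℝ (feature k ζ) (feature k η)) = (-kernelG ζ η).toENNReal := by
  simp only [inner_feature, sum_projCoord_mul]
  rcases (wedgeRatio_nonneg ζ η).eq_or_lt with h0 | h0
  · have hK : kernelG ζ η = ⊥ := by rw [kernelG, ← h0, ENNReal.ofReal_zero, ENNReal.log_zero]
    rw [hK, ← h0, EReal.neg_bot, EReal.toENNReal_top]
    by_contra hne
    have h1 := ENNReal.summable_toReal hne
    have h2 : ∀ k : ℕ, (ENNReal.ofReal (2⁻¹ * ((1 - (0 : ℝ) ^ 2) ^ (k + 1) / (k + 1)))).toReal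
        = 2⁻¹ * (1 / ((k + 1 : ℕ) : ℝ)) := fun k => by
      rw [ENNReal.toReal_ofReal] <;> norm_num
      positivity
    simp only [h2] at h1
    rw [summable_mul_left_iff (by norm_num),
      summable_nat_add_iff (f := fun k : ℕ => 1 / (k : ℝ)) 1] at h1
    exact Real.not_summable_one_div_natCast h1
  · have hle : wedgeRatio ζ η ≤ 1 := div_le_one_of_le₀ (wedgeNorm_le _ _) (by positivity)
    have ht0 : 0 ≤ 1 - wedgeRatio ζ η ^ 2 := sub_nonneg.2 (pow_le_one₀ h0.le hle)
    have hsum := (Real.hasSum_pow_div_log_of_abs_lt_one (x := 1 - wedgeRatio ζ η ^ 2) (by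
      rw [abs_of_nonneg ht0]
      linarith [pow_pos h0 2])).mul_left 2⁻¹
    rw [← ENNReal.ofReal_tsum_of_nonneg (fun k => by positivity) hsum.summable, hsum.tsum_eq,
      kernelG, ENNReal.log_ofReal_of_pos h0, ← EReal.coe_neg,
      EReal.toENNReal_of_ne_top (EReal.coe_ne_top _), EReal.toReal_coe, sub_sub_cancel,
      Real.log_pow]
    congr 1
    push_cast
    ring

theorem seriesEnergy_feature (μ : ProbabilityMeasure (CP n)) :
    seriesEnergy feature (μ : Measure (CP n)) = energy μ := by
  simp only [seriesEnergy, energy, tsum_inner_feature]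

/-- The decreasing homeomorphism `t ↦ exp (-t)` of `[0, ∞]` onto `[0, 1]`. -/
noncomputable def expNeg (t : ℝ≥0∞) : ℝ≥0∞ := EReal.exp (-(t : EReal))

theorem continuous_expNeg : Continuous expNeg :=
  ENNReal.continuous_exp.comp (continuous_neg.comp continuous_coe_ennreal_ereal)

theorem expNeg_antitone : Antitone expNeg := fun _ _ h =>
  EReal.exp_monotone (EReal.neg_le_neg_iff.2 (EReal.coe_ennreal_le_coe_ennreal_iff.2 h))

theorem kappa_eq (E : Set (CP n)) : kappa E = expNeg (minEnergy feature E) := by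
  simp only [kappa, robin, expNeg, minEnergy, seriesEnergy_feature]

theorem kappaOuter_eq (E : Set (CP n)) : kappaOuter E = expNeg (outerMinEnergy feature E) := by
  -- An empty supremum would be sent to `1`, whereas an empty infimum is `⊤`.
  have : Nonempty {O : Set (CP n) // IsOpen O ∧ E ⊆ O} :=
    ⟨⟨Set.univ, isOpen_univ, Set.subset_univ E⟩⟩
  rw [outerMinEnergy, expNeg_antitone.map_ciSup_of_continuousAt continuous_expNeg.continuousAt]
  simp only [kappaOuter, kappa_eq, iInf_subtype, iInf_and]

end Projective

/-! ### Choquet's capacitability theorem -/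

section Capacitability

/-- Choquet's capacitability theorem for a monotone outer regular set function that is continuous
along increasing sequences. -/
theorem exists_isCompact_le_of_analyticSet {X : Type*} [TopologicalSpace X] {c : Set X → ℝ≥0∞}
    (hmono : Monotone c)
    (hunion : ∀ E : ℕ → Set X, Monotone E → Tendsto (fun j => c (E j)) atTop (𝓝 (c (⋃ j, E j))))
    (houter : ∀ K, ∀ b > c K, ∃ O, IsOpen O ∧ K ⊆ O ∧ c O < b)
    {E : Set X} (hE : AnalyticSet E) {a : ℝ≥0∞} (ha : a < c E) :
    ∃ K ⊆ E, IsCompact K ∧ a ≤ c K := by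
  rw [AnalyticSet] at hE
  obtain rfl | ⟨f, hf, rfl⟩ := hE
  · exact ⟨∅, subset_rfl, isCompact_empty, ha.le⟩
  -- Bounding the `j`-th coordinate by growing `m` exhausts `S`, so some bound keeps the value above
  -- `a`.
  have hstep : ∀ (j : ℕ) (S : {S : Set (ℕ → ℕ) // a < c (f '' S)}),
      ∃ m : ℕ, a < c (f '' (S.1 ∩ {x | x j ≤ m})) := by
    rintro j ⟨S, hS⟩
    have hU : ⋃ m : ℕ, f '' (S ∩ {x | x j ≤ m}) = f '' S := by
      rw [← Set.image_iUnion, ← Set.inter_iUnion]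
      congr 1
      refine Set.inter_eq_left.2 fun x _ => Set.mem_iUnion.2 ⟨x j, by simp⟩
    have hlim := hunion (fun m => f '' (S ∩ {x | x j ≤ m})) fun m m' hm =>
      Set.image_mono (Set.inter_subset_inter_right _ fun x hx => le_trans hx hm)
    rw [hU] at hlim
    exact (hlim.eventually (lt_mem_nhds hS)).exists
  choose m hm using hstep
  let T : ℕ → {S : Set (ℕ → ℕ) // a < c (f '' S)} := fun j =>
    Nat.rec ⟨Set.univ, by rwa [Set.image_univ]⟩ (fun j S => ⟨S.1 ∩ {x | x j ≤ m j S}, hm j S⟩) j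
  have hT : ∀ j, ∀ x ∈ (T j).1, ∀ i < j, x i ≤ m i (T i) := by
    intro j
    induction j with
    | zero => intro x _ i hi; omega
    | succ j ih =>
      intro x hx i hi
      rcases Nat.lt_succ_iff_lt_or_eq.1 hi with h | rfl
      · exact ih x hx.1 i h
      · exact hx.2
  set C : Set (ℕ → ℕ) := Set.pi Set.univ fun i => Set.Iic (m i (T i))
  have hCc : IsCompact C := isCompact_univ_pi fun i => (Set.finite_Iic _).isCompact
  have hnhds : ∀ U : Set (ℕ → ℕ), IsOpen U → C ⊆ U → ∃ j, (T j).1 ⊆ U := by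
    intro U hU hCU
    by_contra! hcon
    choose x hxT hxU using fun j => Set.not_subset.1 (hcon j)
    -- Truncation leaves the coordinates `i < j` of `x j` unchanged, so a limit in `C` of truncated
    -- points is also a limit of the original ones.
    have hz : ∀ j, (fun i => min (x j i) (m i (T i))) ∈ C := fun j i _ => by simp
    obtain ⟨z, hzC, φ, hφ, hlim⟩ := hCc.tendsto_subseq hz
    have hx : Tendsto (x ∘ φ) atTop (𝓝 z) := by
      rw [tendsto_pi_nhds] at hlim ⊢
      intro i
      refine (hlim i).congr' ?_
      filter_upwards [hφ.tendsto_atTop.eventually_gt_atTop i] with j hj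
      exact min_eq_left (hT _ _ (hxT (φ j)) i hj)
    obtain ⟨j, hj⟩ := (hx.eventually (hU.mem_nhds (hCU hzC))).exists
    exact hxU (φ j) hj
  refine ⟨f '' C, Set.image_subset_range f C, hCc.image hf, ?_⟩
  by_contra! hlt
  obtain ⟨O, hO, hCO, hOa⟩ := houter _ _ hlt
  obtain ⟨j, hj⟩ := hnhds _ (hO.preimage hf) (Set.image_subset_iff.1 hCO)
  exact lt_asymm hOa ((T j).2.trans_le (hmono (Set.image_subset_iff.2 hj)))

end Capacitability

/-! ### The capacity properties of the outer projective capacity -/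

variable {n : ℕ}

theorem kappa_mono {A B : Set (CP n)} (h : A ⊆ B) : kappa A ≤ kappa B := by
  rw [kappa_eq, kappa_eq]
  exact expNeg_antitone (minEnergy_antitone _ h)

theorem kappaOuter_mono : Monotone (kappaOuter : Set (CP n) → ℝ≥0∞) := fun A B h => by
  rw [kappaOuter_eq, kappaOuter_eq]
  exact expNeg_antitone (outerMinEnergy_antitone _ h)

theorem kappaOuter_le {E O : Set (CP n)} (hO : IsOpen O) (h : E ⊆ O) : kappaOuter E ≤ kappa O :=
  iInf_le_of_le O (iInf₂_le hO h)

theorem exists_isOpen_kappa_lt {E : Set (CP n)} {b : ℝ≥0∞} (h : kappaOuter E < b) :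
    ∃ O, IsOpen O ∧ E ⊆ O ∧ kappa O < b := by
  simpa only [kappaOuter, iInf_lt_iff, exists_prop] using h

theorem kappaOuter_of_isCompact {K : Set (CP n)} (hK : IsCompact K) : kappaOuter K = kappa K := by
  rw [kappaOuter_eq, kappa_eq,
    outerMinEnergy_of_isCompact continuous_feature inner_feature_nonneg hK]

theorem kappa_empty : kappa (∅ : Set (CP n)) = 0 := by
  have h : robin (∅ : Set (CP n)) = ⊤ := by
    refine iInf₂_eq_top.2 fun μ hμ => ?_
    exact absurd (Measure.support_eq_empty_iff.1 (Set.subset_empty_iff.1 hμ))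
      (IsProbabilityMeasure.ne_zero (μ : Measure (CP n)))
  simp [kappa, h]

theorem tendsto_kappaOuter_iUnion {E : ℕ → Set (CP n)} (hE : Monotone E) :
    Tendsto (fun j => kappaOuter (E j)) atTop (𝓝 (kappaOuter (⋃ j, E j))) := by
  simp only [kappaOuter_eq]
  refine (continuous_expNeg.tendsto _).comp ?_
  rw [outerMinEnergy_iUnion continuous_feature inner_feature_nonneg hE]
  exact tendsto_atTop_iInf ((outerMinEnergy_antitone _).comp_monotone hE)

/-- Decreasing compact sets eventually enter any open neighbourhood of their intersection, so outer
regularity suffices. -/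
theorem tendsto_kappaOuter_iInter {K : ℕ → Set (CP n)} (hK : Antitone K)
    (hKc : ∀ j, IsCompact (K j)) :
    Tendsto (fun j => kappaOuter (K j)) atTop (𝓝 (kappaOuter (⋂ j, K j))) := by
  have hanti : Antitone fun j => kappaOuter (K j) := kappaOuter_mono.comp_antitone hK
  have h := tendsto_atTop_iInf hanti
  convert h using 2
  refine le_antisymm (le_iInf fun j => kappaOuter_mono (Set.iInter_subset K j)) ?_
  refine le_of_forall_gt fun b hb => ?_
  obtain ⟨O, hO, hKO, hOb⟩ := exists_isOpen_kappa_lt hb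
  obtain ⟨j, hj⟩ := exists_subset_nhds_of_isCompact' hK.directed_ge hKc (fun j => (hKc j).isClosed)
    fun x hx => hO.mem_nhds (hKO hx)
  exact (iInf_le _ j).trans_lt ((kappaOuter_le hO hj).trans_lt hOb)

theorem isChoquetCapacity_kappaOuter :
    IsChoquetCapacity (fun E : Set (CP n) => kappaOuter E) where
  empty := le_antisymm ((kappaOuter_le isOpen_empty subset_rfl).trans kappa_empty.le) zero_le
  mono _ _ h := kappaOuter_mono h
  tendsto_iUnion _ hE := tendsto_kappaOuter_iUnion hE
  tendsto_iInter _ hK hKc := tendsto_kappaOuter_iInter hK hKc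

theorem isCapacitable_of_measurableSet {E : Set (CP n)} (hE : MeasurableSet E) :
    IsCapacitable E := by
  refine le_antisymm (le_of_forall_lt fun a ha => ?_) ?_
  · let _ : MetricSpace (CP n) := TopologicalSpace.metrizableSpaceMetric (CP n)
    -- The capacitability theorem yields only a weak inequality for the compact set; the
    -- intermediate `b` restores strictness.
    obtain ⟨b, hab, hb⟩ := exists_between ha
    obtain ⟨K, hKE, hK, hbK⟩ := exists_isCompact_le_of_analyticSet kappaOuter_mono
      (fun _ => tendsto_kappaOuter_iUnion)
      (fun A b hb => by
        obtain ⟨O, hO, hAO, hOb⟩ := exists_isOpen_kappa_lt hb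
        exact ⟨O, hO, hAO, (kappaOuter_le hO subset_rfl).trans_lt hOb⟩)
      hE.analyticSet hb
    rw [kappaOuter_of_isCompact hK] at hbK
    exact (hab.trans_le hbK).trans_le (le_iSup_of_le K (le_iSup₂_of_le hK hKE le_rfl))
  · exact iSup_le fun K => iSup₂_le fun _ hKE => le_iInf fun O => le_iInf₂ fun _ hEO =>
      kappa_mono (hKE.trans hEO)

end ProjLog

theorem mainTheorem6 (n : ℕ) :
    ProjLog.IsChoquetCapacity (fun E : Set (ProjLog.CP n) => ProjLog.kappaOuter E) ∧
      ∀ E : Set (ProjLog.CP n), MeasurableSet E → ProjLog.IsCapacitable E :=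
  ⟨ProjLog.isChoquetCapacity_kappaOuter, fun _ hE => ProjLog.isCapacitable_of_measurableSet hE⟩
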